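/- Let $X$ be a separable metric space that is homogeneous, i.e. for any two points $p,q\in X$ there is a homeomorphism of $X$ onto itself that maps $p$ to $q$. Let $U$ be an open cone neighborhood in $X$, i.e. an open subset $U$ of $X$ for which there are a compact metric space $Y$, a point $p\in U$ and a proper continuous map $\phi:Y\times(0,\infty]\to U$ such that $\phi(Y\times\{\infty\})=\{p\}$ and $\phi$ maps $Y\times(0,\infty)$ homeomorphically onto $U\setminus\{p\}$. Then for any $x,y\in U$ there is a homeomorphism $h$ of $X$ onto itself such that $h(x)=y$ and $h$ is supported on $U$, i.e. $h(z)=z$ for every $z\in X\setminus U$. -/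

import Mathlib

open scoped ENNReal

universe u v

/-- A space is homogeneous if any point can be carried to any other one by a homeomorphism of the
whole space. -/
def IsHomogeneousSpace (X : Type u) [TopologicalSpace X] : Prop :=
  ∀ p q : X, ∃ h : X ≃ₜ X, h p = q

/-- The half-open interval `(0, ∞]`, with its usual topology. -/
abbrev PosExt : Type := Set.Ioi (0 : ℝ≥0∞)

/-- `φ : Y × (0, ∞] → U` is a cone chart for `U` with vertex `p`: it is a proper (continuous) map,
it sends `Y × {∞}` onto the one-point set `{p}`, and it maps `Y × (0, ∞)` homeomorphically onto
`U - {p}`. The set `U` carries the subspace topology. -/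
structure IsConeChart {X : Type u} [TopologicalSpace X] {Y : Type v} [TopologicalSpace Y]
    (U : Set X) (φ : Y × PosExt → U) (p : U) : Prop where
  isProperMap : IsProperMap φ
  image_top : φ '' {z | (z.2 : ℝ≥0∞) = ⊤} = {p}
  isEmbedding : Topology.IsEmbedding
    (fun z : {z : Y × PosExt // (z.2 : ℝ≥0∞) ≠ ⊤} => φ z.1)
  image_ne_top : φ '' {z | (z.2 : ℝ≥0∞) ≠ ⊤} = {p}ᶜ

/-- `U` is an open cone neighborhood: an open set which has a cone chart whose base `Y` is a
compact metric space. (`Y` may live in any universe.) -/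
def IsOpenConeNeighborhood {X : Type u} [MetricSpace X] (U : Set X) : Prop :=
  IsOpen U ∧ ∃ (Y : Type v) (_ : MetricSpace Y) (_ : CompactSpace Y) (φ : Y × PosExt → U) (p : U),
    IsConeChart U φ p

/-- A homeomorphism of `X` is supported on `U` if it is the identity on `X - U`. -/
def IsSupportedOn {X : Type u} [TopologicalSpace X] (h : X ≃ₜ X) (U : Set X) : Prop :=
  ∀ z, z ∉ U → h z = z

open Set Filter Topology

/-! The orbits of the homeomorphisms supported on `U` are shown to be open in `U`; since `U` is a
union of rays through one point, it is connected and has a single orbit.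

The engine is `exists_homeomorph_of_interleaved`. Suppose balls of a cone at `p` and of a cone at
`x` interleave. Radial squeezes of the two cones give homeomorphisms `α` and `γ` that agree off a
ball `K` and shrink `K` to `p` and to `x` respectively. Then `γ ^ n ∘ α ^ (-n)` stabilizes at each
point other than `p`, and the limit is a homeomorphism taking `p` to `x`, supported on `K`.

Homogeneity puts a cone at every point, but with no control on how it varies. A Baire argument finds
a point `y` such that interleaving holds for a dense set of points near `y`, so its local orbit
closure is a neighborhood; homogeneity spreads this to all points. Finally, if `w` is near `z`,
small supported moves bring both points so close together that their cones interleave, and closures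
of orbits can be replaced by orbits. -/

/-- A piecewise linear order isomorphism of the line which is the identity off `[e, R]` and moves
`k` to `c`. -/
theorem exists_contracting_profile {e c k R : ℝ} (hec : e < c) (hck : c < k) (hkR : k < R) :
    ∃ F : ℝ ≃o ℝ, (∀ s ≤ e, F s = s) ∧
      (∀ s, e ≤ s → s ≤ k → F s = e + (c - e) / (k - e) * (s - e)) ∧
      (∀ s, k ≤ s → F s = min s (R - (R - c) / (R - k) * (R - s))) ∧ ∀ s, R ≤ s → F s = s := by
  obtain ⟨m, hm⟩ : ∃ m, m = (c - e) / (k - e) := ⟨_, rfl⟩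
  obtain ⟨M, hM⟩ : ∃ M, M = (R - c) / (R - k) := ⟨_, rfl⟩
  rw [← hm, ← hM]
  have hm' : m * (k - e) = c - e := by rw [hm]; field_simp [sub_ne_zero.2 (hec.trans hck).ne']
  have hM' : M * (R - k) = R - c := by rw [hM]; field_simp [sub_ne_zero.2 hkR.ne']
  have hm0 : 0 < m := by rw [hm]; exact div_pos (by linarith) (by linarith)
  have hm1 : m < 1 := by rw [hm, div_lt_one] <;> linarith
  have hM1 : 1 < M := by rw [hM, one_lt_div] <;> linarith
  -- The two lines, of slopes `m < 1 < M`, cross at `(k, c)`, so `max` changes line at `k`; `min`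
  -- with `s` gives the identity off `[e, R]`.
  set f : ℝ → ℝ := fun s => min s (max (e + m * (s - e)) (R - M * (R - s))) with hf
  have hmono : StrictMono f := by
    intro a b hab
    have h1 := mul_lt_mul_of_pos_left hab hm0
    have h2 := mul_lt_mul_of_pos_left hab (zero_lt_one.trans hM1)
    exact min_lt_min hab (max_lt_max (by linarith) (by linarith))
  have hcont : Continuous f := by fun_prop
  have hlow : ∀ s ≤ e, f s = s := by
    intro s hs
    refine min_eq_left (le_max_of_le_left ?_)
    nlinarith
  have hhigh : ∀ s, R ≤ s → f s = s := by
    intro s hs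
    refine min_eq_left (le_max_of_le_right ?_)
    nlinarith
  have hsurj : Function.Surjective f := by
    refine hcont.surjective ?_ ?_
    · exact tendsto_id.congr' ((eventually_ge_atTop R).mono fun s hs => (hhigh s hs).symm)
    · exact tendsto_id.congr' ((eventually_le_atBot e).mono fun s hs => (hlow s hs).symm)
  refine ⟨hmono.orderIsoOfSurjective f hsurj, hlow, fun s h1 h2 => ?_, fun s h1 => ?_, hhigh⟩
  · change f s = _
    have : R - M * (R - s) ≤ e + m * (s - e) := by nlinarith
    rw [hf]
    simp only
    rw [max_eq_left this, min_eq_right]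
    nlinarith
  · change f s = _
    have : e + m * (s - e) ≤ R - M * (R - s) := by nlinarith
    rw [hf]
    simp only
    rw [max_eq_right this]

/-! ### Conjugating contractions that agree off a set -/

section Conjugation

variable {X : Type u} [TopologicalSpace X]

theorem iterate_symm_notMem {α : X ≃ₜ X} {K : Set X} (hα : MapsTo α K K) {z : X} {m n : ℕ}
    (hmn : m ≤ n) (hz : α.symm^[m] z ∉ K) : α.symm^[n] z ∉ K := by
  induction n, hmn using Nat.le_induction with
  | base => exact hz
  | succ n _ ih =>
    rw [Function.iterate_succ_apply']
    intro h
    apply ih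
    simpa using hα h

/-- A backward `α`-orbit that has left `K` never returns, and off `K` each further `γ` cancels an
`α⁻¹`. -/
theorem iterate_symm_stable {α γ : X ≃ₜ X} {K : Set X} (hα : MapsTo α K K) (h : EqOn α γ Kᶜ)
    {z : X} {m n : ℕ} (hmn : m ≤ n) (hz : α.symm^[m] z ∉ K) :
    γ^[n] (α.symm^[n] z) = γ^[m] (α.symm^[m] z) := by
  induction n, hmn using Nat.le_induction with
  | base => rfl
  | succ n hn ih =>
    rw [← ih, Function.iterate_succ_apply γ, Function.iterate_succ_apply' α.symm,
      ← h, α.apply_symm_apply]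
    have := iterate_symm_notMem hα (hn.trans n.le_succ) hz
    rwa [Function.iterate_succ_apply'] at this

open Classical in
/-- The limit of the maps `γ ^ n ∘ α ^ (-n)`, for homeomorphisms `α` and `γ` which agree off `K`
and map `K` into itself. The points that never leave `K` under `α⁻¹` are sent to `x`. -/
noncomputable def conjugationLimit (α γ : X ≃ₜ X) (K : Set X) (x : X) (z : X) : X :=
  if H : ∃ n : ℕ, α.symm^[n] z ∉ K then γ^[H.choose] (α.symm^[H.choose] z) else x

theorem conjugationLimit_eq {α γ : X ≃ₜ X} {K : Set X} (hα : MapsTo α K K) (h : EqOn α γ Kᶜ)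
    (x : X) {z : X} {n : ℕ} (hz : α.symm^[n] z ∉ K) :
    conjugationLimit α γ K x z = γ^[n] (α.symm^[n] z) := by
  have H : ∃ n : ℕ, α.symm^[n] z ∉ K := ⟨n, hz⟩
  rw [conjugationLimit, dif_pos H]
  rcases le_total n H.choose with hn | hn
  · exact iterate_symm_stable hα h hn hz
  · exact (iterate_symm_stable hα h hn H.choose_spec).symm

theorem conjugationLimit_of_forall {α γ : X ≃ₜ X} {K : Set X} (x : X) {z : X}
    (hz : ∀ n : ℕ, α.symm^[n] z ∈ K) : conjugationLimit α γ K x z = x := by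
  rw [conjugationLimit, dif_neg]
  push Not
  exact hz

/-- `K` is an attracting neighborhood of the fixed point `p` of `α`. -/
structure IsAttracting (α : X ≃ₜ X) (K : Set X) (p : X) : Prop where
  isClosed : IsClosed K
  mapsTo : MapsTo α K K
  apply_eq : α p = p
  mem_nhds : K ∈ 𝓝 p
  basis : ∀ W ∈ 𝓝 p, ∃ n : ℕ, α^[n] '' K ⊆ W

namespace IsAttracting

variable {α γ : X ≃ₜ X} {K : Set X} {p x : X}

theorem iterate_symm_fixed (hα : IsAttracting α K p) (n : ℕ) : α.symm^[n] p = p :=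
  Function.iterate_fixed (by rw [α.symm_apply_eq, hα.apply_eq]) n

theorem exists_notMem [T1Space X] (hα : IsAttracting α K p) {z : X} (hz : z ≠ p) :
    ∃ n : ℕ, α.symm^[n] z ∉ K := by
  obtain ⟨n, hn⟩ := hα.basis {z}ᶜ (isOpen_compl_singleton.mem_nhds hz.symm)
  refine ⟨n, fun h => ?_⟩
  exact hn ⟨_, h, (Function.LeftInverse.iterate α.apply_symm_apply n) z⟩ rfl

theorem conjugationLimit_vertex (hα : IsAttracting α K p) :
    conjugationLimit α γ K x p = x :=
  conjugationLimit_of_forall x fun n => by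
    rw [hα.iterate_symm_fixed]; exact mem_of_mem_nhds hα.mem_nhds

/-- If `α⁻ⁿ z` is off `K`, it is also the `n`-th backward `γ`-iterate of the image of `z`, so both
limits are computed at the same `n`. -/
theorem leftInverse [T1Space X] (hα : IsAttracting α K p) (hγ : IsAttracting γ K x)
    (h : EqOn α γ Kᶜ) :
    Function.LeftInverse (conjugationLimit γ α K p) (conjugationLimit α γ K x) := by
  intro z
  by_cases hz : z = p
  · rw [hz, hα.conjugationLimit_vertex, hγ.conjugationLimit_vertex]
  · obtain ⟨n, hn⟩ := hα.exists_notMem hz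
    have e := Function.LeftInverse.iterate γ.symm_apply_apply n (α.symm^[n] z)
    rw [conjugationLimit_eq hα.mapsTo h x hn,
      conjugationLimit_eq hγ.mapsTo h.symm p (n := n) (by rwa [e]), e]
    exact Function.LeftInverse.iterate α.apply_symm_apply n z

/-- Away from `p` the limit is locally `γⁿ ∘ α⁻ⁿ` for a fixed `n`. Near `p`, where `α⁻ⁿ w ∈ K`, the
image of `w` lies in `γⁿ K`: otherwise the inverse limit would give `γ⁻ⁿ` of the image equal to `α⁻ⁿ
w`, which is in `K`. -/
theorem continuous_conjugationLimit [T1Space X] (hα : IsAttracting α K p)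
    (hγ : IsAttracting γ K x) (h : EqOn α γ Kᶜ) : Continuous (conjugationLimit α γ K x) := by
  rw [continuous_iff_continuousAt]
  intro z
  by_cases hz : z = p
  · subst hz
    rw [ContinuousAt, hα.conjugationLimit_vertex]
    refine fun W hW => mem_map.2 ?_
    obtain ⟨n, hn⟩ := hγ.basis W hW
    have hc : Tendsto (α.symm^[n]) (𝓝 z) (𝓝 z) := by
      have := (α.symm.continuous.iterate n).tendsto z
      rwa [hα.iterate_symm_fixed] at this
    filter_upwards [hc.eventually_mem hα.mem_nhds] with w hw
    apply hn
    refine ⟨γ.symm^[n] (conjugationLimit α γ K x w), ?_,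
      Function.LeftInverse.iterate γ.apply_symm_apply n _⟩
    by_contra hK
    have h1 := conjugationLimit_eq hγ.mapsTo h.symm z hK
    rw [hα.leftInverse hγ h] at h1
    apply hK
    have h2 := Function.LeftInverse.iterate α.symm_apply_apply n
      (γ.symm^[n] (conjugationLimit α γ K x w))
    rw [← h1] at h2
    rwa [← h2]
  · obtain ⟨n, hn⟩ := hα.exists_notMem hz
    have hc : Continuous (α.symm^[n]) := α.symm.continuous.iterate n
    have hev : ∀ᶠ w in 𝓝 z, α.symm^[n] w ∉ K :=
      hc.continuousAt.eventually (hα.isClosed.isOpen_compl.mem_nhds hn)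
    refine (((γ.continuous.iterate n).comp hc).continuousAt).congr ?_
    filter_upwards [hev] with w hw
    exact (conjugationLimit_eq hα.mapsTo h x hw).symm

/-- Two homeomorphisms which agree off a common attracting neighborhood of their fixed points are
conjugate, by a homeomorphism which is the identity off that neighborhood. -/
theorem exists_homeomorph [T1Space X] (hα : IsAttracting α K p) (hγ : IsAttracting γ K x)
    (h : EqOn α γ Kᶜ) : ∃ g : X ≃ₜ X, g p = x ∧ IsSupportedOn g K := by
  refine ⟨⟨⟨conjugationLimit α γ K x, conjugationLimit γ α K p, hα.leftInverse hγ h,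
    hγ.leftInverse hα h.symm⟩, hα.continuous_conjugationLimit hγ h,
    hγ.continuous_conjugationLimit hα h.symm⟩, hα.conjugationLimit_vertex, fun z hz => ?_⟩
  exact conjugationLimit_eq hα.mapsTo h x (n := 0) hz

end IsAttracting

end Conjugation

/-! ### Cones and their radial homeomorphisms -/

/-- `Φ` restricted to `Y × [0, ∞)` is a parametrization of an open cone with vertex `p`; the real
coordinate is the distance to the vertex. -/
structure IsConeAt {X : Type u} [TopologicalSpace X] {Y : Type v} [TopologicalSpace Y]
    (Φ : Y × ℝ → X) (p : X) : Prop where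
  continuous : Continuous Φ
  nonempty : Nonempty Y
  apply_zero : ∀ y, Φ (y, 0) = p
  radius_eq : ∀ {y y' s s'}, 0 ≤ s → 0 ≤ s' → Φ (y, s) = Φ (y', s') → s = s'
  base_eq : ∀ {y y' s}, 0 < s → Φ (y, s) = Φ (y', s) → y = y'
  isOpen_image : ∀ r, IsOpen (Φ '' (univ ×ˢ Ico 0 r))

/-- The closed ball of radius `r` around the vertex of a cone. -/
def coneClosedBall {X : Type u} {Y : Type v} (Φ : Y × ℝ → X) (r : ℝ) : Set X :=
  Φ '' (univ ×ˢ Icc 0 r)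

/-- The open ball of radius `r` around the vertex of a cone. -/
def coneBall {X : Type u} {Y : Type v} (Φ : Y × ℝ → X) (r : ℝ) : Set X :=
  Φ '' (univ ×ˢ Ico 0 r)

section Balls

variable {X : Type u} {Y : Type v} {Φ : Y × ℝ → X}

theorem coneBall_subset_coneClosedBall {r r' : ℝ} (h : r ≤ r') : coneBall Φ r ⊆ coneClosedBall Φ r' :=
  image_mono (prod_mono_right (Ico_subset_Icc_self.trans (Icc_subset_Icc_right h)))

theorem coneClosedBall_subset_coneBall {r r' : ℝ} (h : r < r') : coneClosedBall Φ r ⊆ coneBall Φ r' :=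
  image_mono (prod_mono_right (Icc_subset_Ico_right h))

theorem coneClosedBall_mono {r r' : ℝ} (h : r ≤ r') : coneClosedBall Φ r ⊆ coneClosedBall Φ r' :=
  image_mono (prod_mono_right (Icc_subset_Icc_right h))

theorem coneClosedBall_comp (f : X → X) (r : ℝ) :
    coneClosedBall (f ∘ Φ) r = f '' coneClosedBall Φ r := image_comp _ _ _

theorem iterate_apply_ray {g : X → X} {k m : ℝ} (hm0 : 0 ≤ m) (hm1 : m < 1)
    (hg : ∀ y s, 0 ≤ s → s ≤ k → g (Φ (y, s)) = Φ (y, m * s)) (n : ℕ) (y : Y) {s : ℝ}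
    (hs : 0 ≤ s) (hk : s ≤ k) : g^[n] (Φ (y, s)) = Φ (y, m ^ n * s) := by
  induction n with
  | zero => simp
  | succ n ih =>
    have h1 : m ^ n ≤ 1 := pow_le_one₀ hm0 hm1.le
    have h2 : 0 ≤ m ^ n := by positivity
    rw [Function.iterate_succ_apply', ih, hg _ _ (by positivity) (by nlinarith), pow_succ']
    ring_nf

end Balls

section Support

variable {X : Type u} [TopologicalSpace X]

theorem IsSupportedOn.mono {g : X ≃ₜ X} {A B : Set X} (h : IsSupportedOn g A) (hAB : A ⊆ B) :
    IsSupportedOn g B := fun z hz => h z fun hA => hz (hAB hA)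

theorem IsSupportedOn.symm {g : X ≃ₜ X} {A : Set X} (h : IsSupportedOn g A) :
    IsSupportedOn g.symm A := fun z hz => by rw [g.symm_apply_eq, h z hz]

theorem IsSupportedOn.trans {f g : X ≃ₜ X} {A : Set X} (hf : IsSupportedOn f A)
    (hg : IsSupportedOn g A) : IsSupportedOn (f.trans g) A := fun z hz => by
  rw [Homeomorph.trans_apply, hf z hz, hg z hz]

theorem IsSupportedOn.mapsTo {g : X ≃ₜ X} {A : Set X} (h : IsSupportedOn g A) : MapsTo g A A := by
  intro z hz
  by_contra hn
  exact hn ((g.injective (h _ hn)).symm ▸ hz)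

theorem IsSupportedOn.image_eq {g : X ≃ₜ X} {A : Set X} (h : IsSupportedOn g A) : g '' A = A := by
  refine h.mapsTo.image_subset.antisymm fun z hz => ⟨g.symm z, h.symm.mapsTo hz, by simp⟩

end Support

namespace IsConeAt

variable {X : Type u} [TopologicalSpace X] {Y : Type v} [TopologicalSpace Y]
  {Φ : Y × ℝ → X} {p : X}

theorem mem_closedBall (hΦ : IsConeAt Φ p) {y : Y} {s r : ℝ} (hs : 0 ≤ s) :
    Φ (y, s) ∈ coneClosedBall Φ r ↔ s ≤ r := by
  constructor
  · rintro ⟨⟨y', s'⟩, ⟨-, h0, h1⟩, e⟩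
    exact (hΦ.radius_eq h0 hs e) ▸ h1
  · exact fun h => ⟨(y, s), ⟨mem_univ _, hs, h⟩, rfl⟩

theorem mem_ball (hΦ : IsConeAt Φ p) {y : Y} {s r : ℝ} (hs : 0 ≤ s) :
    Φ (y, s) ∈ coneBall Φ r ↔ s < r := by
  constructor
  · rintro ⟨⟨y', s'⟩, ⟨-, h0, h1⟩, e⟩
    exact (hΦ.radius_eq h0 hs e) ▸ h1
  · exact fun h => ⟨(y, s), ⟨mem_univ _, hs, h⟩, rfl⟩

theorem isOpen_ball (hΦ : IsConeAt Φ p) (r : ℝ) : IsOpen (coneBall Φ r) := hΦ.isOpen_image r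

theorem vertex_mem_ball (hΦ : IsConeAt Φ p) {r : ℝ} (hr : 0 < r) : p ∈ coneBall Φ r := by
  obtain ⟨y⟩ := hΦ.nonempty
  rw [← hΦ.apply_zero y]
  exact (hΦ.mem_ball le_rfl).2 hr

theorem ball_mem_nhds (hΦ : IsConeAt Φ p) {r : ℝ} (hr : 0 < r) : coneBall Φ r ∈ 𝓝 p :=
  (hΦ.isOpen_ball r).mem_nhds (hΦ.vertex_mem_ball hr)

theorem closedBall_mem_nhds (hΦ : IsConeAt Φ p) {r : ℝ} (hr : 0 < r) : coneClosedBall Φ r ∈ 𝓝 p :=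
  mem_of_superset (hΦ.ball_mem_nhds hr) (coneBall_subset_coneClosedBall le_rfl)

theorem comp_homeomorph (hΦ : IsConeAt Φ p) (f : X ≃ₜ X) : IsConeAt (f ∘ Φ) (f p) where
  continuous := f.continuous.comp hΦ.continuous
  nonempty := hΦ.nonempty
  apply_zero y := congrArg f (hΦ.apply_zero y)
  radius_eq h h' e := hΦ.radius_eq h h' (f.injective e)
  base_eq h e := hΦ.base_eq h (f.injective e)
  isOpen_image r := by
    rw [image_comp]
    exact f.isOpenMap _ (hΦ.isOpen_image r)

open Classical in
/-- The map which reparametrizes the rays of a cone by `F` and fixes all other points. -/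
noncomputable def radialMap {X : Type u} {Y : Type v} (Φ : Y × ℝ → X) (F : ℝ → ℝ) (z : X) : X :=
  if h : ∃ q : Y × ℝ, 0 ≤ q.2 ∧ Φ q = z then Φ (h.choose.1, F h.choose.2) else z

theorem radialMap_apply (hΦ : IsConeAt Φ p) {F : ℝ → ℝ} (h0 : F 0 = 0) (y : Y) {s : ℝ}
    (hs : 0 ≤ s) : radialMap Φ F (Φ (y, s)) = Φ (y, F s) := by
  have h : ∃ q : Y × ℝ, 0 ≤ q.2 ∧ Φ q = Φ (y, s) := ⟨(y, s), hs, rfl⟩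
  rw [radialMap, dif_pos h]
  obtain ⟨h1, h2⟩ := h.choose_spec
  generalize h.choose = q at h1 h2
  obtain ⟨y', s'⟩ := q
  obtain rfl := hΦ.radius_eq h1 hs h2
  rcases hs.eq_or_lt with rfl | hs
  · simp [h0, hΦ.apply_zero]
  · rw [hΦ.base_eq hs h2]

theorem radialMap_of_notMem (hΦ : IsConeAt Φ p) {F : ℝ → ℝ} (h0 : F 0 = 0) {R : ℝ}
    (hR : ∀ s, R ≤ s → F s = s) {z : X} (hz : z ∉ coneBall Φ R) : radialMap Φ F z = z := by
  by_cases h : ∃ q : Y × ℝ, 0 ≤ q.2 ∧ Φ q = z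
  · obtain ⟨⟨y, s⟩, hs, rfl⟩ := h
    rw [hΦ.mem_ball hs, not_lt] at hz
    rw [hΦ.radialMap_apply h0 y hs, hR s hz]
  · rw [radialMap, dif_neg h]

theorem radialMap_leftInverse (hΦ : IsConeAt Φ p) {F G : ℝ → ℝ} (hF : ∀ s, 0 ≤ s → 0 ≤ F s)
    (hF0 : F 0 = 0) (hG0 : G 0 = 0) (h : Function.LeftInverse G F) :
    Function.LeftInverse (radialMap Φ G) (radialMap Φ F) := by
  intro z
  by_cases hz : ∃ q : Y × ℝ, 0 ≤ q.2 ∧ Φ q = z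
  · obtain ⟨⟨y, s⟩, hs, rfl⟩ := hz
    rw [hΦ.radialMap_apply hF0 y hs, hΦ.radialMap_apply hG0 y (hF s hs), h s]
  · have e : ∀ F : ℝ → ℝ, radialMap Φ F z = z := fun F => by rw [radialMap, dif_neg hz]
    rw [e F, e G]

variable [CompactSpace Y]

theorem isCompact_closedBall (hΦ : IsConeAt Φ p) (r : ℝ) : IsCompact (coneClosedBall Φ r) :=
  (isCompact_univ.prod isCompact_Icc).image hΦ.continuous

theorem exists_closedBall_subset (hΦ : IsConeAt Φ p) {W : Set X} (hW : W ∈ 𝓝 p) {R : ℝ}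
    (hR : 0 < R) : ∃ r, 0 < r ∧ r < R ∧ coneClosedBall Φ r ⊆ W := by
  obtain ⟨W', hW', ho, hp⟩ := mem_nhds_iff.1 hW
  obtain ⟨u, v, -, hv, hu, h0, huv⟩ := generalized_tube_lemma (isCompact_univ (X := Y))
    (isCompact_singleton (x := (0 : ℝ))) (ho.preimage hΦ.continuous) (by
      rintro ⟨y, s⟩ ⟨-, rfl⟩
      simpa [hΦ.apply_zero] using hp)
  obtain ⟨ε, hε, hb⟩ := Metric.isOpen_iff.1 hv 0 (h0 rfl)
  refine ⟨min (ε / 2) (R / 2), by positivity, (min_le_right _ _).trans_lt (by linarith), ?_⟩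
  rintro _ ⟨⟨y, s⟩, ⟨-, h1, h2⟩, rfl⟩
  refine hW' (huv ⟨hu (mem_univ y), hb ?_⟩)
  rw [mem_ball_zero_iff, Real.norm_of_nonneg h1]
  exact (h2.trans (min_le_left _ _)).trans_lt (by linarith)

/-- The preimage of a closed set is a compact image of part of `Y × [0, R]` together with a closed
set off the open ball, where the map is the identity. -/
theorem continuous_radialMap [T2Space X] (hΦ : IsConeAt Φ p) {F : ℝ → ℝ} (hF : Continuous F)
    (h0 : F 0 = 0) {R : ℝ} (hR : ∀ s, R ≤ s → F s = s) : Continuous (radialMap Φ F) := by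
  rw [continuous_iff_isClosed]
  intro Z hZ
  have : radialMap Φ F ⁻¹' Z =
      Φ '' (univ ×ˢ Icc 0 R ∩ {q | Φ (q.1, F q.2) ∈ Z}) ∪ (Z ∩ (coneBall Φ R)ᶜ) := by
    ext z
    constructor
    · intro hz
      by_cases hb : z ∈ coneBall Φ R
      · left
        obtain ⟨⟨y, s⟩, ⟨-, hs, hs'⟩, rfl⟩ := hb
        rw [mem_preimage, hΦ.radialMap_apply h0 y hs] at hz
        exact ⟨(y, s), ⟨⟨mem_univ _, hs, le_of_lt hs'⟩, hz⟩, rfl⟩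
      · rw [mem_preimage, hΦ.radialMap_of_notMem h0 hR hb] at hz
        exact .inr ⟨hz, hb⟩
    · rintro (⟨⟨y, s⟩, ⟨⟨-, hs, -⟩, hz⟩, rfl⟩ | ⟨hz, hb⟩)
      · rw [mem_preimage, hΦ.radialMap_apply h0 y hs]
        exact hz
      · rw [mem_preimage, hΦ.radialMap_of_notMem h0 hR hb]
        exact hz
  rw [this]
  refine IsClosed.union (IsCompact.isClosed (IsCompact.image ?_ hΦ.continuous))
    (hZ.inter (hΦ.isOpen_ball R).isClosed_compl)
  refine (isCompact_univ.prod isCompact_Icc).inter_right ?_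
  have := hΦ.continuous
  exact hZ.preimage (by fun_prop)

theorem exists_radial_homeomorph [T2Space X] (hΦ : IsConeAt Φ p) (F : ℝ ≃o ℝ) (h0 : F 0 = 0)
    {R : ℝ} (hR : ∀ s, R ≤ s → F s = s) :
    ∃ g : X ≃ₜ X, (∀ y s, 0 ≤ s → g (Φ (y, s)) = Φ (y, F s)) ∧ IsSupportedOn g (coneBall Φ R) := by
  have h0' : F.symm 0 = 0 := by rw [F.symm_apply_eq, h0]
  have hR' : ∀ s, R ≤ s → F.symm s = s := fun s hs => by rw [F.symm_apply_eq, hR s hs]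
  have hp : ∀ s, 0 ≤ s → 0 ≤ F s := fun s hs => h0 ▸ F.monotone hs
  have hp' : ∀ s, 0 ≤ s → 0 ≤ F.symm s := fun s hs => h0' ▸ F.symm.monotone hs
  exact ⟨⟨⟨radialMap Φ F, radialMap Φ F.symm,
      hΦ.radialMap_leftInverse hp h0 h0' F.symm_apply_apply,
      hΦ.radialMap_leftInverse hp' h0' h0 F.apply_symm_apply⟩,
    hΦ.continuous_radialMap F.continuous h0 hR, hΦ.continuous_radialMap F.symm.continuous h0' hR'⟩,
    fun y s hs => hΦ.radialMap_apply h0 y hs, fun z hz => hΦ.radialMap_of_notMem h0 hR hz⟩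

theorem exists_iterate_image_subset (hΦ : IsConeAt Φ p) {g : X → X} {k m : ℝ}
    (hm0 : 0 ≤ m) (hm1 : m < 1)
    (hg : ∀ y s, 0 ≤ s → s ≤ k → g (Φ (y, s)) = Φ (y, m * s)) {W : Set X} (hW : W ∈ 𝓝 p) :
    ∃ n : ℕ, g^[n] '' coneClosedBall Φ k ⊆ W := by
  obtain ⟨r, hr, -, hrW⟩ := hΦ.exists_closedBall_subset hW one_pos
  have ht : Tendsto (fun n : ℕ => m ^ n * k) atTop (𝓝 (0 * k)) :=
    (tendsto_pow_atTop_nhds_zero_of_lt_one hm0 hm1).mul_const k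
  rw [zero_mul] at ht
  obtain ⟨n, hn⟩ := (ht.eventually_lt_const hr).exists
  refine ⟨n, ?_⟩
  rintro _ ⟨_, ⟨⟨y, s⟩, ⟨-, hs, hk⟩, rfl⟩, rfl⟩
  apply hrW
  have h2 : 0 ≤ m ^ n := by positivity
  rw [iterate_apply_ray hm0 hm1 hg n y hs hk, hΦ.mem_closedBall (by positivity)]
  exact (mul_le_mul_of_nonneg_left hk h2).trans hn.le

/-- If two cones interleave, then some homeomorphism supported on the larger one carries the vertex
of the first one to the vertex of the second one. -/
theorem exists_homeomorph_of_interleaved [T2Space X] (hΦ : IsConeAt Φ p)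
    {Y' : Type*} [TopologicalSpace Y'] [CompactSpace Y'] {Ψ : Y' × ℝ → X} {x : X}
    (hΨ : IsConeAt Ψ x) {k c c' b₀ b : ℝ} (hc' : 0 < c') (hc : c' < c) (hk : c < k) (hb : 0 < b)
    (hb₀ : b < b₀) (h1 : coneClosedBall Ψ b₀ ⊆ coneClosedBall Φ k)
    (h2 : coneClosedBall Φ c ⊆ coneClosedBall Ψ b) (hx : x ∈ coneBall Φ c') :
    ∃ g : X ≃ₜ X, g p = x ∧ IsSupportedOn g (coneClosedBall Φ k) := by
  -- `α'` will be the identity on the `c'`-ball of `Φ`. Squeezing the `b`-ball of `Ψ` into it makes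
  -- `α' ∘ β` linear on the rays of that `b`-ball.
  obtain ⟨d, hd0, hdb, hd⟩ :=
    hΨ.exists_closedBall_subset ((hΦ.isOpen_ball c').mem_nhds hx) hb
  have hk0 : 0 < k := by linarith
  obtain ⟨F, F1, F2, F3, F4⟩ := exists_contracting_profile (hc'.trans hc) hk (lt_add_one k)
  obtain ⟨F', F1', F2', F3', F4'⟩ := exists_contracting_profile hc hk (lt_add_one k)
  obtain ⟨G, G1, G2, G3, G4⟩ := exists_contracting_profile hd0 hdb hb₀
  simp only [sub_zero, zero_add] at F2 G2
  obtain ⟨α, α1, α2⟩ := hΦ.exists_radial_homeomorph F (F1 0 le_rfl) F4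
  obtain ⟨α', α1', α2'⟩ := hΦ.exists_radial_homeomorph F' (F1' 0 hc'.le) F4'
  obtain ⟨β, β1, β2⟩ := hΨ.exists_radial_homeomorph G (G1 0 le_rfl) G4
  have hβ : IsSupportedOn β (coneClosedBall Ψ b₀) :=
    β2.mono (coneBall_subset_coneClosedBall le_rfl)
  have hβK := hβ.mono h1
  have e1 : ∀ y s, 0 ≤ s → s ≤ k → α (Φ (y, s)) = Φ (y, c / k * s) := fun y s h0 hs => by
    rw [α1 y s h0, F2 s h0 hs]
  have hm0 : 0 ≤ c / k := div_nonneg (by linarith) hk0.le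
  have hm1 : c / k < 1 := (div_lt_one hk0).2 hk
  have hn0 : 0 ≤ d / b := div_nonneg hd0.le hb.le
  have hn1 : d / b < 1 := (div_lt_one hb).2 hdb
  have hαα' : EqOn α α' (coneClosedBall Φ k)ᶜ := by
    intro z hz
    by_cases hq : ∃ q : Y × ℝ, 0 ≤ q.2 ∧ Φ q = z
    · obtain ⟨⟨y, s⟩, hs, rfl⟩ := hq
      rw [mem_compl_iff, hΦ.mem_closedBall hs, not_le] at hz
      -- Beyond `k` the profile formula does not involve the lower breakpoint, which is `0` for `F`
      -- and `c'` for `F'`.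
      rw [α1 y s hs, α1' y s hs, F3 s hz.le, F3' s hz.le]
    · have e : z ∉ coneBall Φ (k + 1) := by
        rintro ⟨⟨y, s⟩, ⟨-, hs, -⟩, rfl⟩
        exact hq ⟨(y, s), hs, rfl⟩
      rw [α2 z e, α2' z e]
  have hα'K : MapsTo α' (coneClosedBall Φ k) (coneClosedBall Φ c) := by
    rintro _ ⟨⟨y, s⟩, ⟨-, hs, hsk⟩, rfl⟩
    have h0 : 0 ≤ F' s := F1' 0 hc'.le ▸ F'.monotone hs
    rw [α1' y s hs, hΦ.mem_closedBall h0]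
    refine (F'.monotone hsk).trans (le_of_eq ?_)
    rw [F2' k (hc.trans hk).le le_rfl, div_mul_cancel₀ _ (by linarith)]
    ring
  have hα'c : ∀ z ∈ coneClosedBall Φ c', α' z = z := by
    rintro _ ⟨⟨y, s⟩, ⟨-, hs, hsk⟩, rfl⟩
    rw [α1' y s hs, F1' s hsk]
  have e2 : ∀ y s, 0 ≤ s → s ≤ b → (β.trans α') (Ψ (y, s)) = Ψ (y, d / b * s) := by
    intro y s h0 hs
    have hds : d / b * s ≤ d := by
      rw [div_mul_eq_mul_div, div_le_iff₀ hb]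
      exact mul_le_mul_of_nonneg_left hs hd0.le
    rw [Homeomorph.trans_apply, β1 y s h0, G2 s h0 hs]
    exact hα'c _ (coneBall_subset_coneClosedBall le_rfl
      (hd ((hΨ.mem_closedBall (by positivity)).2 hds)))
  have hγK : MapsTo (β.trans α') (coneClosedBall Φ k) (coneClosedBall Φ c) :=
    hα'K.comp hβK.mapsTo
  have hA : IsAttracting α (coneClosedBall Φ k) p :=
    { isClosed := (hΦ.isCompact_closedBall k).isClosed
      mapsTo := by
        rintro _ ⟨⟨y, s⟩, ⟨-, hs, hsk⟩, rfl⟩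
        rw [e1 y s hs hsk, hΦ.mem_closedBall (by positivity)]
        nlinarith
      apply_eq := by
        obtain ⟨y⟩ := hΦ.nonempty
        have := e1 y 0 le_rfl hk0.le
        rwa [mul_zero, hΦ.apply_zero] at this
      mem_nhds := hΦ.closedBall_mem_nhds hk0
      basis := fun W hW => hΦ.exists_iterate_image_subset hm0 hm1 e1 hW }
  have hB : IsAttracting (β.trans α') (coneClosedBall Φ k) x :=
    { isClosed := (hΦ.isCompact_closedBall k).isClosed
      mapsTo := hγK.mono_right (coneClosedBall_mono hk.le)
      apply_eq := by
        obtain ⟨y⟩ := hΨ.nonempty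
        have := e2 y 0 le_rfl hb.le
        rwa [mul_zero, hΨ.apply_zero] at this
      mem_nhds := mem_of_superset ((hΦ.isOpen_ball c').mem_nhds hx)
        (coneBall_subset_coneClosedBall (hc.trans hk).le)
      basis := fun W hW => by
        obtain ⟨n, hn⟩ := hΨ.exists_iterate_image_subset hn0 hn1 e2 hW
        -- The extra iterate first carries the `k`-ball of `Φ` into the `c`-ball, hence into the
        -- `b`-ball of `Ψ`, where the linear contraction applies.
        refine ⟨n + 1, ?_⟩
        rw [Function.iterate_succ, image_comp]
        exact (image_mono (hγK.image_subset.trans h2)).trans hn }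
  refine hA.exists_homeomorph hB fun z hz => ?_
  rw [Homeomorph.trans_apply, hβK z hz, hαα' hz]

end IsConeAt

/-! ### From a cone chart to a cone with a radius coordinate -/

section Chart

variable {X : Type u} [TopologicalSpace X] {Y : Type v} [TopologicalSpace Y]
  {U : Set X} {φ : Y × PosExt → U} {p : U}

theorem IsConeChart.apply_top (h : IsConeChart U φ p) {z : Y × PosExt} (hz : (z.2 : ℝ≥0∞) = ⊤) :
    φ z = p := by
  have : φ z ∈ φ '' {z | (z.2 : ℝ≥0∞) = ⊤} := ⟨z, hz, rfl⟩
  rwa [h.image_top] at this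

theorem IsConeChart.apply_ne (h : IsConeChart U φ p) {z : Y × PosExt} (hz : (z.2 : ℝ≥0∞) ≠ ⊤) :
    φ z ≠ p := by
  have : φ z ∈ φ '' {z | (z.2 : ℝ≥0∞) ≠ ⊤} := ⟨z, hz, rfl⟩
  rwa [h.image_ne_top] at this

theorem IsConeChart.eq_or_eq (h : IsConeChart U φ p) {z w : Y × PosExt} (e : φ z = φ w) :
    z = w ∨ (z.2 : ℝ≥0∞) = ⊤ ∧ (w.2 : ℝ≥0∞) = ⊤ := by
  by_cases hz : (z.2 : ℝ≥0∞) = ⊤ <;> by_cases hw : (w.2 : ℝ≥0∞) = ⊤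
  · exact .inr ⟨hz, hw⟩
  · exact absurd (e.symm.trans (h.apply_top hz)) (h.apply_ne hw)
  · exact absurd (e.trans (h.apply_top hw)) (h.apply_ne hz)
  · exact .inl (congrArg Subtype.val (h.isEmbedding.injective (a₁ := ⟨z, hz⟩) (a₂ := ⟨w, hw⟩) e))

theorem IsConeChart.surjective (h : IsConeChart U φ p) : Function.Surjective φ := by
  intro u
  by_cases hu : u = p
  · have : u ∈ φ '' {z | (z.2 : ℝ≥0∞) = ⊤} := by rw [h.image_top, hu]; rfl
    exact ⟨this.choose, this.choose_spec.2⟩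
  · have : u ∈ φ '' {z | (z.2 : ℝ≥0∞) ≠ ⊤} := by rw [h.image_ne_top]; exact hu
    exact ⟨this.choose, this.choose_spec.2⟩

/-- The inversion `s ↦ s⁻¹` from the line to `(0, ∞]`, equal to `∞` on nonpositive numbers. -/
noncomputable def invPosExt (s : ℝ) : PosExt :=
  ⟨(ENNReal.ofReal s)⁻¹, ENNReal.inv_pos.2 ENNReal.ofReal_ne_top⟩

theorem continuous_invPosExt : Continuous invPosExt :=
  (continuous_inv.comp ENNReal.continuous_ofReal).subtype_mk _

theorem invPosExt_zero : (invPosExt 0 : ℝ≥0∞) = ⊤ := by simp [invPosExt]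

theorem invPosExt_ne_top {s : ℝ} (hs : 0 < s) : (invPosExt s : ℝ≥0∞) ≠ ⊤ := by
  simpa [invPosExt] using hs

theorem invPosExt_inj {s t : ℝ} (hs : 0 ≤ s) (ht : 0 ≤ t)
    (h : (invPosExt s : ℝ≥0∞) = invPosExt t) : s = t := by
  have := inv_injective h
  rwa [ENNReal.ofReal_eq_ofReal_iff hs ht] at this

theorem exists_invPosExt_eq (t : PosExt) : ∃ s, 0 ≤ s ∧ invPosExt s = t := by
  refine ⟨(t : ℝ≥0∞)⁻¹.toReal, ENNReal.toReal_nonneg, Subtype.ext ?_⟩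
  have : (t : ℝ≥0∞)⁻¹ ≠ ⊤ := ENNReal.inv_ne_top.2 (ne_of_gt t.2)
  simp only [invPosExt]
  rw [ENNReal.ofReal_toReal this, inv_inv]

theorem invPosExt_lt_iff {s r : ℝ} (hr : 0 < r) :
    (invPosExt r : ℝ≥0∞) < invPosExt s ↔ s < r := by
  simp only [invPosExt]
  rw [ENNReal.inv_lt_inv, ENNReal.ofReal_lt_ofReal_iff hr]

theorem IsConeChart.exists_isConeAt (h : IsConeChart U φ p) (hU : IsOpen U) :
    ∃ Φ : Y × ℝ → X, IsConeAt Φ p ∧ Φ '' (univ ×ˢ Ici 0) = U := by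
  have hcont : Continuous fun q : Y × ℝ => (φ (q.1, invPosExt q.2) : X) :=
    continuous_subtype_val.comp (h.isProperMap.continuous.comp
      (continuous_fst.prodMk (continuous_invPosExt.comp continuous_snd)))
  refine ⟨fun q => φ (q.1, invPosExt q.2), ⟨hcont, ?_, ?_, ?_, ?_, ?_⟩, ?_⟩
  · obtain ⟨z, -⟩ := h.surjective p
    exact ⟨z.1⟩
  · exact fun y => congrArg Subtype.val (h.apply_top invPosExt_zero)
  · intro y y' s s' hs hs' e
    refine invPosExt_inj hs hs' ?_
    rcases h.eq_or_eq (Subtype.ext e) with h1 | ⟨h1, h2⟩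
    · exact congrArg Subtype.val (Prod.ext_iff.1 h1).2
    · exact h1.trans h2.symm
  · intro y y' s hs e
    rcases h.eq_or_eq (Subtype.ext e) with h1 | ⟨h1, -⟩
    · exact (Prod.ext_iff.1 h1).1
    · exact absurd h1 (invPosExt_ne_top hs)
  · intro r
    rcases le_or_gt r 0 with hr | hr
    · rw [Ico_eq_empty (not_lt.2 hr), prod_empty, image_empty]
      exact isOpen_empty
    -- Radius at least `r` means chart coordinate at most `1 / r`. The proper map `φ` sends this
    -- closed set to the complement of the ball in `U`.
    have hZ : IsClosed {z : Y × PosExt | (z.2 : ℝ≥0∞) ≤ invPosExt r} :=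
      isClosed_le (continuous_subtype_val.comp continuous_snd) continuous_const
    have ho := hU.isOpenMap_subtype_val _ (h.isProperMap.isClosedMap _ hZ).isOpen_compl
    convert ho using 1
    ext x
    constructor
    · rintro ⟨⟨y, s⟩, ⟨-, hs, hsr⟩, rfl⟩
      refine ⟨_, ?_, rfl⟩
      rintro ⟨z, hz, e⟩
      have hlt := (invPosExt_lt_iff hr).2 hsr
      rcases h.eq_or_eq e with rfl | ⟨h1, -⟩
      · exact absurd hz (not_le.2 hlt)
      · rw [mem_ofPred_eq, h1, top_le_iff] at hz
        exact invPosExt_ne_top hr hz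
    · rintro ⟨w, hw, rfl⟩
      obtain ⟨⟨y, t⟩, rfl⟩ := h.surjective w
      obtain ⟨s, hs, rfl⟩ := exists_invPosExt_eq t
      refine ⟨(y, s), ⟨mem_univ _, hs, ?_⟩, rfl⟩
      rw [← invPosExt_lt_iff hr, ← not_le]
      exact fun hle => hw ⟨_, hle, rfl⟩
  · ext x
    constructor
    · rintro ⟨q, -, rfl⟩
      exact Subtype.property _
    · intro hx
      obtain ⟨⟨y, t⟩, e⟩ := h.surjective ⟨x, hx⟩
      obtain ⟨s, hs, rfl⟩ := exists_invPosExt_eq t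
      exact ⟨(y, s), ⟨mem_univ _, hs⟩, congrArg Subtype.val e⟩

end Chart

/-- The image is a union of rays, each connected and containing `p`. -/
theorem IsConeAt.isPreconnected_image {X : Type u} [TopologicalSpace X] {Y : Type v}
    [TopologicalSpace Y] {Φ : Y × ℝ → X} {p : X} (hΦ : IsConeAt Φ p) :
    IsPreconnected (Φ '' (univ ×ˢ Ici 0)) := by
  have : Φ '' (univ ×ˢ Ici 0) = ⋃ y : Y, Φ '' ({y} ×ˢ Ici 0) := by
    rw [← image_iUnion, ← iUnion_prod_const, iUnion_of_singleton]
  rw [this]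
  exact isPreconnected_iUnion ⟨p, mem_iInter.2 fun y => ⟨(y, 0), ⟨rfl, self_mem_Ici⟩, hΦ.apply_zero y⟩⟩
    fun y => (isPreconnected_singleton.prod isPreconnected_Ici).image _ hΦ.continuous.continuousOn

/-! ### Local orbits in a homogeneous space -/

section Homogeneous

variable {X : Type u} [TopologicalSpace X]

/-- The orbit of `z` under the homeomorphisms of `X` supported on `W`. -/
def supportedOrbit (W : Set X) (z : X) : Set X :=
  {w | ∃ g : X ≃ₜ X, g z = w ∧ IsSupportedOn g W}

theorem supportedOrbit_symm {W : Set X} {z w : X} (h : w ∈ supportedOrbit W z) :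
    z ∈ supportedOrbit W w := by
  obtain ⟨g, rfl, hg⟩ := h
  exact ⟨g.symm, g.symm_apply_apply z, hg.symm⟩

theorem supportedOrbit_trans {W : Set X} {z w t : X} (h : w ∈ supportedOrbit W z)
    (h' : t ∈ supportedOrbit W w) : t ∈ supportedOrbit W z := by
  obtain ⟨g, rfl, hg⟩ := h
  obtain ⟨g', rfl, hg'⟩ := h'
  exact ⟨g.trans g', rfl, hg.trans hg'⟩

theorem self_mem_supportedOrbit (W : Set X) (z : X) : z ∈ supportedOrbit W z :=
  ⟨Homeomorph.refl X, rfl, fun _ _ => rfl⟩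

/-- A second countable space has a countable family of sets which interpolates between compact
sets and their open neighborhoods. -/
theorem exists_countable_interpolating [SecondCountableTopology X] :
    ∃ 𝓑 : Set (Set X), 𝓑.Countable ∧
      ∀ M O : Set X, IsCompact M → IsOpen O → M ⊆ O → ∃ B ∈ 𝓑, M ⊆ B ∧ B ⊆ O := by
  have hb := TopologicalSpace.isBasis_countableBasis X
  refine ⟨sUnion '' {s | s.Finite ∧ s ⊆ TopologicalSpace.countableBasis X},
    (countable_ofPred_finite_subset (TopologicalSpace.countable_countableBasis X)).image _, ?_⟩
  intro M O hM hO hMO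
  obtain ⟨t, ht, htf, hMt⟩ := hM.elim_finite_subcover_image
    (b := {s ∈ TopologicalSpace.countableBasis X | s ⊆ O}) (c := id)
    (fun s hs => hb.isOpen hs.1) (by
      intro z hz
      obtain ⟨s, hs, hzs, hsO⟩ := hb.exists_subset_of_mem_open (hMO hz) hO
      exact mem_biUnion (show s ∈ {s ∈ _ | s ⊆ O} from ⟨hs, hsO⟩) hzs)
  refine ⟨⋃₀ t, ⟨t, ⟨htf, fun s hs => (ht hs).1⟩, rfl⟩, ?_, sUnion_subset fun s hs => (ht hs).2⟩
  rwa [sUnion_eq_biUnion]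

/-- In a Baire space, for every countable family of sets some point lies in the interior of the
closure of each member of the family that contains it. -/
theorem exists_mem_interior_closure_of_mem [BaireSpace X] [Nonempty X] {ι : Type*} [Countable ι]
    (S : ι → Set X) : ∃ y, ∀ i, y ∈ S i → y ∈ interior (closure (S i)) := by
  -- The frontier of a closed set has empty interior, so some point avoids all these frontiers.
  have hd : Dense (⋂ i, (frontier (closure (S i)))ᶜ) :=
    dense_iInter_of_isOpen (fun i => isClosed_frontier.isOpen_compl) fun i =>
      interior_eq_empty_iff_dense_compl.1 (interior_frontier isClosed_closure)
  obtain ⟨y, hy⟩ := hd.nonempty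
  refine ⟨y, fun i hi => ?_⟩
  by_contra hn
  exact mem_iInter.1 hy i ⟨subset_closure (subset_closure hi), hn⟩

variable {Y : Type v} [TopologicalSpace Y] [CompactSpace Y] {Φ : Y × ℝ → X} {p : X}

theorem IsConeAt.locallyCompactSpace [T2Space X] (hΦ : IsConeAt Φ p) (hX : IsHomogeneousSpace X) :
    LocallyCompactSpace X := by
  have : WeaklyLocallyCompactSpace X := ⟨fun x => by
    obtain ⟨f, rfl⟩ := hX p x
    exact ⟨_, (hΦ.comp_homeomorph f).isCompact_closedBall 1,
      (hΦ.comp_homeomorph f).closedBall_mem_nhds one_pos⟩⟩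
  infer_instance

/-- In a homogeneous space with cone neighborhoods, the closure of the orbit of a point under locally
supported homeomorphisms is a neighborhood of that point. -/
theorem IsConeAt.closure_supportedOrbit_mem_nhds [T2Space X] [SecondCountableTopology X]
    (hΦ : IsConeAt Φ p) (hX : IsHomogeneousSpace X) {W : Set X} {z : X} (hW : W ∈ 𝓝 z) :
    closure (supportedOrbit W z) ∈ 𝓝 z := by
  have := hΦ.locallyCompactSpace hX
  have : Nonempty X := ⟨p⟩
  choose f hf using hX p
  have hcone : ∀ x, IsConeAt (f x ∘ Φ) x := fun x => by
    have := hΦ.comp_homeomorph (f x)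
    rwa [hf] at this
  obtain ⟨𝓑, h𝓑, hint⟩ := exists_countable_interpolating (X := X)
  have : Countable 𝓑 := h𝓑
  let ρ : ℕ → ℝ := fun n => 1 / ((n : ℝ) + 1)
  have hρ0 : ∀ n, 0 < ρ n := fun n => Nat.one_div_pos_of_nat
  have hρ : ∀ n, ρ (n + 1) < ρ n := fun n => Nat.one_div_lt_one_div n.lt_succ_self
  -- The choice of `f x` is arbitrary in `x`. The countable index records the size of the cone at
  -- `x`: its `ρ n`-ball lies in `B`, its `ρ (n + 1)`-ball contains `B'`.
  obtain ⟨y, hy⟩ := exists_mem_interior_closure_of_mem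
    fun i : 𝓑 × 𝓑 × ℕ => {x | coneClosedBall (f x ∘ Φ) (ρ i.2.2) ⊆ i.1 ∧
      (i.2.1 : Set X) ⊆ coneClosedBall (f x ∘ Φ) (ρ (i.2.2 + 1))}
  obtain ⟨g, rfl⟩ := hX y z
  have key : closure (supportedOrbit (g ⁻¹' W) y) ∈ 𝓝 y := by
    obtain ⟨k, hk, -, hkW⟩ := (hcone y).exists_closedBall_subset
      (g.continuous.continuousAt.preimage_mem_nhds hW) one_pos
    -- Radii `c' < c < ρ (n + 1) < ρ n < k`, with `B` and `B'` fitted in the outer and inner gaps at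
    -- `y`, make the cone at `y` interleave with that at any `x` of the same index set lying in the
    -- `c'`-ball.
    obtain ⟨n, hn⟩ := exists_nat_one_div_lt hk
    obtain ⟨c, hc0, hc⟩ := exists_between (hρ0 (n + 1))
    obtain ⟨c', hc'0, hc'⟩ := exists_between hc0
    obtain ⟨B, hB, hB1, hB2⟩ := hint _ _ ((hcone y).isCompact_closedBall (ρ n))
      ((hcone y).isOpen_ball k) (coneClosedBall_subset_coneBall hn)
    obtain ⟨B', hB', hB1', hB2'⟩ := hint _ _ ((hcone y).isCompact_closedBall c)
      ((hcone y).isOpen_ball (ρ (n + 1))) (coneClosedBall_subset_coneBall hc)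
    have hyS := hy (⟨B, hB⟩, ⟨B', hB'⟩, n)
      ⟨hB1, hB2'.trans (coneBall_subset_coneClosedBall le_rfl)⟩
    have hO := (hcone y).isOpen_ball c'
    refine mem_of_superset (inter_mem (isOpen_interior.mem_nhds hyS)
      ((hcone y).ball_mem_nhds hc'0)) ?_
    rintro w ⟨hw1, hw2⟩
    have := hO.inter_closure ⟨hw2, interior_subset hw1⟩
    refine closure_mono ?_ this
    rintro x ⟨hx, hx1, hx2⟩
    obtain ⟨e, he, hes⟩ := (hcone y).exists_homeomorph_of_interleaved (hcone x) hc'0 hc'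
      ((hc.trans (hρ n)).trans hn) (hρ0 (n + 1)) (hρ n)
      ((hx1.trans hB2).trans (coneBall_subset_coneClosedBall le_rfl)) (hB1'.trans hx2) hx
    exact ⟨e, he, hes.mono hkW⟩
  have h2 := g.isOpenMap.image_mem_nhds key
  refine mem_of_superset h2 ?_
  rw [g.image_closure]
  refine closure_mono ?_
  rintro _ ⟨_, ⟨e, rfl, he⟩, rfl⟩
  refine ⟨(g.symm.trans e).trans g, by simp, fun t ht => ?_⟩
  simp only [Homeomorph.trans_apply]
  rw [he, g.apply_symm_apply]
  simpa using ht

/-- In a homogeneous space with cone neighborhoods, the orbit of a point under locally supported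
homeomorphisms is a neighborhood of that point. -/
theorem IsConeAt.supportedOrbit_mem_nhds [T2Space X] [SecondCountableTopology X]
    (hΦ : IsConeAt Φ p) (hX : IsHomogeneousSpace X) {W : Set X} {z : X} (hW : W ∈ 𝓝 z) :
    supportedOrbit W z ∈ 𝓝 z := by
  have hcone : ∀ x, ∃ Ψ : Y × ℝ → X, IsConeAt Ψ x := fun x => by
    obtain ⟨f, rfl⟩ := hX p x
    exact ⟨_, hΦ.comp_homeomorph f⟩
  obtain ⟨Φz, hz⟩ := hcone z
  obtain ⟨k, hk, -, hkW⟩ := hz.exists_closedBall_subset hW one_pos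
  have hVo := hz.isOpen_ball k
  have hV := hz.ball_mem_nhds hk
  have hVk : coneBall Φz k ⊆ coneClosedBall Φz k := coneBall_subset_coneClosedBall le_rfl
  refine mem_of_superset (inter_mem hV (hΦ.closure_supportedOrbit_mem_nhds hX hV)) ?_
  rintro w ⟨hwV, hw⟩
  obtain ⟨Ψ, hΨ⟩ := hcone w
  obtain ⟨b₀, hb₀, -, hbV⟩ := hΨ.exists_closedBall_subset (hVo.mem_nhds hwV) one_pos
  obtain ⟨b, hb, hbb₀⟩ := exists_between hb₀
  have hN := hΦ.closure_supportedOrbit_mem_nhds hX (hΨ.ball_mem_nhds hb)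
  -- `z` is moved to `g z`, interior to the orbit closure of `w`; then `w` can be moved as close to
  -- `g z` as needed.
  obtain ⟨_, hgN, g, rfl, hg⟩ := mem_closure_iff_nhds.1 hw _
    (inter_mem (interior_mem_nhds.2 hN) (hΨ.ball_mem_nhds hb))
  have hgz := hz.comp_homeomorph g
  obtain ⟨c, hc, hck, hcb⟩ := hgz.exists_closedBall_subset
    ((hΨ.isOpen_ball b).mem_nhds hgN.2) hk
  obtain ⟨c', hc', hc'c⟩ := exists_between hc
  obtain ⟨_, hhw, h, rfl, hh⟩ := mem_closure_iff_nhds.1 (interior_subset hgN.1) _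
    (hgz.ball_mem_nhds hc')
  -- The moves shift the vertices but preserve, as sets, the balls that contain their supports, so
  -- the inclusions needed for interleaving survive.
  have hk' : coneClosedBall (g ∘ Φz) k = coneClosedBall Φz k := by
    rw [coneClosedBall_comp, (hg.mono hVk).image_eq]
  have hball : ∀ r, b ≤ r → coneClosedBall (h ∘ Ψ) r = coneClosedBall Ψ r := fun r hr => by
    rw [coneClosedBall_comp, (hh.mono (coneBall_subset_coneClosedBall hr)).image_eq]
  obtain ⟨e, he, hes⟩ := hgz.exists_homeomorph_of_interleaved (hΨ.comp_homeomorph h) hc' hc'c hck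
    hb hbb₀ (by rw [hball b₀ hbb₀.le, hk']; exact hbV.trans hVk)
    (by rw [hball b le_rfl]; exact hcb.trans (coneBall_subset_coneClosedBall le_rfl)) hhw
  rw [hk'] at hes
  have h1 : g z ∈ supportedOrbit W z := ⟨g, rfl, hg.mono (hVk.trans hkW)⟩
  have h2 : h w ∈ supportedOrbit W (g z) := ⟨e, he, hes.mono hkW⟩
  have h3 : h w ∈ supportedOrbit W w := ⟨h, rfl, hh.mono
    ((coneBall_subset_coneClosedBall hbb₀.le).trans (hbV.trans (hVk.trans hkW)))⟩
  exact supportedOrbit_trans (supportedOrbit_trans h1 h2) (supportedOrbit_symm h3)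

end Homogeneous

theorem lemma2 {X : Type u} [MetricSpace X] [TopologicalSpace.SeparableSpace X]
    (hX : IsHomogeneousSpace X) (U : Set X) (hU : IsOpenConeNeighborhood.{u, v} U)
    (x y : X) (hx : x ∈ U) (hy : y ∈ U) :
    ∃ h : X ≃ₜ X, h x = y ∧ IsSupportedOn h U := by
  have : SecondCountableTopology X := UniformSpace.secondCountable_of_separable X
  obtain ⟨hUo, Y, _, _, φ, p, hφ⟩ := hU
  obtain ⟨Φ, hΦ, rfl⟩ := hφ.exists_isConeAt hUo
  set U := Φ '' (univ ×ˢ Ici 0)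
  have hopen : ∀ z, IsOpen (U ∩ supportedOrbit U z) := fun z => isOpen_iff_mem_nhds.2 fun w hw =>
    inter_mem (hUo.mem_nhds hw.1) (mem_of_superset
      (hΦ.supportedOrbit_mem_nhds hX (hUo.mem_nhds hw.1)) fun _ ht => supportedOrbit_trans hw.2 ht)
  by_contra hxy
  -- The orbit of `x` and the union of the other orbits would be two open sets disconnecting `U`.
  obtain ⟨w, -, ⟨-, hwx⟩, hw⟩ := hΦ.isPreconnected_image (U ∩ supportedOrbit U x)
    (⋃ z ∈ (supportedOrbit U x)ᶜ, U ∩ supportedOrbit U z) (hopen x)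
    (isOpen_biUnion fun z _ => hopen z)
    (fun w hw => by
      by_cases h : w ∈ supportedOrbit U x
      · exact .inl ⟨hw, h⟩
      · exact .inr (mem_biUnion (mem_compl h) ⟨hw, self_mem_supportedOrbit U w⟩))
    ⟨x, hx, hx, self_mem_supportedOrbit U x⟩
    ⟨y, hy, mem_biUnion (mem_compl hxy) ⟨hy, self_mem_supportedOrbit U y⟩⟩
  obtain ⟨z, hz, -, hwz⟩ := mem_iUnion₂.1 hw
  exact hz (supportedOrbit_trans hwx (supportedOrbit_symm hwz))
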